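/- Let $M$ be a smooth manifold of dimension $2n+1$ ($n \ge 0$) without boundary and let $\alpha$ be a contact form on $M$, that is, a smooth nowhere vanishing $1$-form such that $d\alpha$ is non-degenerate on the hyperplanes $\xi_p = \ker \alpha_p$. Let $R_\alpha$ be the Reeb vector field, determined by $\alpha(R_\alpha)=1$ and $d\alpha(R_\alpha,\cdot)=0$. For a smooth function $G$ on $M$ let $X_G$ be its contact vector field, determined by $$\alpha(X_G) = G, \qquad d\alpha(X_G,\cdot) = dG(R_\alpha)\,\alpha - dG .$$ The contact Poisson bracket of $F, G \in C_c^\infty(M)$ is $$\{F,G\}_c = dF(X_G) - dG(R_\alpha)\,F .$$ Let $Y \subset M$ be an embedded submanifold without boundary, of any dimension and not necessarily closed as a subset. $Y$ is called contact coisotropic if for every $p \in Y$ $$(T_pY \cap \xi_p)^{\perp_{d\alpha}} \subset T_pY \cap \xi_p ,$$ where $W^{\perp_{d\alpha}} = \{ v \in \xi_p : d\alpha(v,w) = 0 \text{ for all } w \in W\}$ for $W \subset \xi_p$. Let $I_Y = \{F \in C_c^\infty(M) : F|_Y = 0\}$, an ideal of $C_c^\infty(M)$. Then $Y$ is contact coisotropic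 if and only if $I_Y$ is a Lie subalgebra with respect to the contact Poisson bracket, i.e. $\{F,G\}_c \in I_Y$ for all $F,G \in I_Y$. Likewise, $Y$ is contact coisotropic if and only if $dF(X_G) + dG(R_\alpha)\,F \in I_Y$ for all $F,G \in I_Y$. -/

import Mathlib

open scoped Manifold ContDiff Topology

noncomputable section

namespace ContactGeometry

/-! ### Linear algebra of a contact covector -/

section LinearAlgebra

variable {V : Type*} [AddCommGroup V] [Module ℝ V] [FiniteDimensional ℝ V]

/-- If `σ` is an alternating form on `V` that is non-degenerate on `ker a`, where `a ≠ 0`, then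
`v ↦ σ(v, ·) + a(v) a` is a bijection from `V` to its dual. -/
theorem contact_bijective (a : V →ₗ[ℝ] ℝ) (σ : V →ₗ[ℝ] V →ₗ[ℝ] ℝ) (hσ : ∀ v, σ v v = 0)
    (hnd : ∀ v, a v = 0 → (∀ w, a w = 0 → σ v w = 0) → v = 0) :
    Function.Bijective (fun v : V => σ v + a v • a) := by
  let Φ : V →ₗ[ℝ] Module.Dual ℝ V := σ + a.smulRight a
  have hΦ : ∀ v, Φ v = σ v + a v • a := fun v => rfl
  have hinj : Function.Injective Φ := by
    rw [injective_iff_map_eq_zero]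
    intro v hv
    have h1 : ∀ w, σ v w + a v * a w = 0 := fun w => by
      have := LinearMap.congr_fun hv w
      simpa [hΦ] using this
    have h2 : a v = 0 := by
      have := h1 v
      rw [hσ, zero_add] at this
      exact mul_self_eq_zero.mp this
    exact hnd v h2 fun w _ => by simpa [h2] using h1 w
  have hsurj : Function.Surjective Φ :=
    (LinearMap.injective_iff_surjective_of_finrank_eq_finrank
      (Subspace.dual_finrank_eq (K := ℝ) (V := V)).symm).mp hinj
  exact ⟨hinj, hsurj⟩

theorem existsUnique_reeb (a : V →ₗ[ℝ] ℝ) (σ : V →ₗ[ℝ] V →ₗ[ℝ] ℝ) (hσ : ∀ v, σ v v = 0)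
    (ha : a ≠ 0) (hnd : ∀ v, a v = 0 → (∀ w, a w = 0 → σ v w = 0) → v = 0) :
    ∃! r : V, a r = 1 ∧ ∀ w, σ r w = 0 := by
  have hb := contact_bijective a σ hσ hnd
  obtain ⟨r, hr⟩ := hb.2 a
  have h1 : ∀ w, σ r w + a r * a w = a w := fun w => by
    have := LinearMap.congr_fun hr w
    simpa using this
  have hr1 : a r = 1 := by
    by_contra hne
    have h2 : a r = 0 := by
      have := h1 r
      rw [hσ, zero_add] at this
      have h3 : a r * (a r - 1) = 0 := by linarith
      rcases mul_eq_zero.mp h3 with h | h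
      · exact h
      · exact absurd (by linarith) hne
    have h0 : r = 0 := hnd r h2 fun w hw => by simpa [h2, hw] using h1 w
    apply ha
    ext w
    have := h1 w
    simp [h0] at this
    simpa using this.symm
  refine ⟨r, ⟨hr1, fun w => by have := h1 w; rw [hr1] at this; linarith⟩, ?_⟩
  rintro s ⟨hs1, hs⟩
  apply hb.1
  ext w
  have := h1 w
  simp [hs1, hs, hr1] at this ⊢
  linarith

/-- With `r` the Reeb vector of `(a, σ)`: for every covector `b` and every number `c` there is
exactly one `v` with `a(v) = c` and `σ(v, ·) = b(r) a - b`. -/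
theorem existsUnique_contactVector (a : V →ₗ[ℝ] ℝ) (σ : V →ₗ[ℝ] V →ₗ[ℝ] ℝ)
    (hσ : ∀ v, σ v v = 0) (hnd : ∀ v, a v = 0 → (∀ w, a w = 0 → σ v w = 0) → v = 0)
    (r : V) (hr1 : a r = 1) (hr : ∀ w, σ r w = 0) (b : V →ₗ[ℝ] ℝ) (c : ℝ) :
    ∃! v : V, a v = c ∧ ∀ w, σ v w = b r * a w - b w := by
  have hb := contact_bijective a σ hσ hnd
  have hskew : ∀ v, σ v r = 0 := fun v => by
    have := hσ (v + r)
    simp [hσ, hr] at this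
    exact this
  obtain ⟨v, hv⟩ := hb.2 (b r • a - b + c • a)
  have h1 : ∀ w, σ v w + a v * a w = b r * a w - b w + c * a w := fun w => by
    have := LinearMap.congr_fun hv w
    simpa using this
  have hc : a v = c := by
    have := h1 r
    rw [hskew, hr1] at this
    linarith
  refine ⟨v, ⟨hc, fun w => by have := h1 w; rw [hc] at this; linarith⟩, ?_⟩
  rintro u ⟨hu1, hu⟩
  apply hb.1
  ext w
  have := h1 w
  simp [hu1, hu, hc] at this ⊢
  linarith

end LinearAlgebra

/-! ### One-forms on a manifold and their exterior derivative -/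

/-- The model space of `d`-dimensional manifolds. -/
abbrev Model (d : ℕ) : Type := EuclideanSpace ℝ (Fin d)

section Forms

variable {d : ℕ} {M : Type*} [TopologicalSpace M] [ChartedSpace (Model d) M]

/-- A (not necessarily smooth) 1-form on `M`: a covector at every point. -/
abbrev OneForm (d : ℕ) (M : Type*) [TopologicalSpace M] [ChartedSpace (Model d) M] : Type _ :=
  ∀ p : M, TangentSpace (𝓡 d) p →L[ℝ] ℝ

/-- A 1-form is smooth if it is a smooth section of the cotangent bundle
`Hom(TM, ℝ)`. -/
def OneForm.IsSmooth [IsManifold (𝓡 d) ∞ M] (a : OneForm d M) : Prop :=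
  ContMDiff (𝓡 d) ((𝓡 d).prod 𝓘(ℝ, Model d →L[ℝ] ℝ)) ∞
    (fun p : M => (Bundle.TotalSpace.mk' (Model d →L[ℝ] ℝ) p (a p) :
      Bundle.TotalSpace (Model d →L[ℝ] ℝ)
        (fun p : M => TangentSpace (𝓡 d) p →L[ℝ] Bundle.Trivial M ℝ p)))

/-- The expression of a 1-form in the preferred chart at `p`, i.e. its pullback under the inverse of
that chart, which is a 1-form on (an open subset of) `ℝ^d`. -/
def OneForm.inChart (a : OneForm d M) (p : M) (y : Model d) : Model d →L[ℝ] ℝ :=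
  (a ((extChartAt (𝓡 d) p).symm y)).comp
    (mfderiv 𝓘(ℝ, Model d) (𝓡 d) (extChartAt (𝓡 d) p).symm y)

/-- The bilinear form `(u, v) ↦ (D_u b)(v) - (D_v b)(u)` on `ℝ^d` at the point `y`: the exterior
derivative of the 1-form `b` on `ℝ^d`. -/
def flatExtDeriv (b : Model d → (Model d →L[ℝ] ℝ)) (y : Model d) :
    Model d →ₗ[ℝ] Model d →ₗ[ℝ] ℝ :=
  LinearMap.mk₂ ℝ (fun u v => fderiv ℝ b y u v - fderiv ℝ b y v u)
    (fun _ _ _ => by simp; ring) (fun _ _ _ => by simp; ring)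
    (fun _ _ _ => by simp; ring) (fun _ _ _ => by simp; ring)

/-- The exterior derivative `da` of a 1-form at `p`: the exterior derivative of its expression in
the chart at `p`, pulled back to the tangent space at `p` by the derivative of the chart. -/
def OneForm.extDeriv (a : OneForm d M) (p : M) :
    TangentSpace (𝓡 d) p →ₗ[ℝ] TangentSpace (𝓡 d) p →ₗ[ℝ] ℝ :=
  let D : TangentSpace (𝓡 d) p →ₗ[ℝ] Model d :=
    (mfderiv (𝓡 d) 𝓘(ℝ, Model d) (extChartAt (𝓡 d) p) p).toLinearMap
  (flatExtDeriv (a.inChart p) (extChartAt (𝓡 d) p p)).compl₁₂ D D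

theorem OneForm.extDeriv_apply (a : OneForm d M) (p : M) (u v : TangentSpace (𝓡 d) p) :
    a.extDeriv p u v = flatExtDeriv (a.inChart p) (extChartAt (𝓡 d) p p)
      (mfderiv (𝓡 d) 𝓘(ℝ, Model d) (extChartAt (𝓡 d) p) p u)
      (mfderiv (𝓡 d) 𝓘(ℝ, Model d) (extChartAt (𝓡 d) p) p v) :=
  rfl

theorem OneForm.extDeriv_self (a : OneForm d M) (p : M) (v : TangentSpace (𝓡 d) p) :
    a.extDeriv p v v = 0 :=
  sub_self (_ : ℝ)

end Forms

/-! ### Contact forms -/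

/-- A contact form on a `(2n+1)`-dimensional manifold: a smooth 1-form `α` that vanishes nowhere and
whose exterior derivative is non-degenerate on the hyperplanes `ξ_p = ker α_p`. -/
structure ContactForm (n : ℕ) (M : Type*) [TopologicalSpace M]
    [ChartedSpace (Model (2 * n + 1)) M] [IsManifold (𝓡 (2 * n + 1)) ∞ M] where
  /-- the underlying 1-form -/
  form : OneForm (2 * n + 1) M
  smooth : form.IsSmooth
  ne_zero : ∀ p, form p ≠ 0
  nondegenerate : ∀ (p : M) (v : TangentSpace (𝓡 (2 * n + 1)) p), form p v = 0 →
    (∀ w : TangentSpace (𝓡 (2 * n + 1)) p, form p w = 0 → form.extDeriv p v w = 0) → v = 0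

section Contact

variable {n : ℕ} {M : Type*} [TopologicalSpace M]
  [ChartedSpace (Model (2 * n + 1)) M] [IsManifold (𝓡 (2 * n + 1)) ∞ M]

namespace ContactForm

/-- The hyperplane `ξ_p = ker α_p`. -/
def hyperplane (α : ContactForm n M) (p : M) : Submodule ℝ (TangentSpace (𝓡 (2 * n + 1)) p) :=
  LinearMap.ker (α.form p).toLinearMap

/-- The symplectic orthogonal complement in `(ξ_p, dα_p|_ξ)` of a subspace `W` of `ξ_p`. -/
def orthogonal (α : ContactForm n M) (p : M) (W : Submodule ℝ (TangentSpace (𝓡 (2 * n + 1)) p)) :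
    Submodule ℝ (TangentSpace (𝓡 (2 * n + 1)) p) where
  carrier := {v | v ∈ α.hyperplane p ∧ ∀ w ∈ W, α.form.extDeriv p v w = 0}
  add_mem' := by
    rintro u v ⟨hu, hu'⟩ ⟨hv, hv'⟩
    exact ⟨add_mem hu hv, fun w hw => by simp [hu' w hw, hv' w hw]⟩
  zero_mem' := ⟨zero_mem _, fun w _ => by simp⟩
  smul_mem' := by
    rintro c v ⟨hv, hv'⟩
    exact ⟨Submodule.smul_mem _ c hv, fun w hw => by simp [hv' w hw]⟩

theorem existsUnique_reebField (α : ContactForm n M) (p : M) :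
    ∃! r : TangentSpace (𝓡 (2 * n + 1)) p,
      α.form p r = 1 ∧ ∀ w : TangentSpace (𝓡 (2 * n + 1)) p, α.form.extDeriv p r w = 0 :=
  haveI : FiniteDimensional ℝ (TangentSpace (𝓡 (2 * n + 1)) p) :=
    inferInstanceAs (FiniteDimensional ℝ (Model (2 * n + 1)))
  existsUnique_reeb (α.form p).toLinearMap (α.form.extDeriv p) (α.form.extDeriv_self p)
    (fun h => α.ne_zero p (ContinuousLinearMap.coe_injective h)) (α.nondegenerate p)

/-- The Reeb vector field `R_α`, determined by `α(R_α) = 1` and `dα(R_α, ·) = 0`. -/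
def reebField (α : ContactForm n M) (p : M) : TangentSpace (𝓡 (2 * n + 1)) p :=
  (α.existsUnique_reebField p).choose

theorem reebField_spec (α : ContactForm n M) (p : M) :
    α.form p (α.reebField p) = 1 ∧
      ∀ w : TangentSpace (𝓡 (2 * n + 1)) p, α.form.extDeriv p (α.reebField p) w = 0 :=
  (α.existsUnique_reebField p).choose_spec.1

theorem existsUnique_contactVectorField (α : ContactForm n M) (G : M → ℝ) (p : M) :
    ∃! v : TangentSpace (𝓡 (2 * n + 1)) p, α.form p v = G p ∧
      ∀ w : TangentSpace (𝓡 (2 * n + 1)) p, α.form.extDeriv p v w =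
        mvfderiv (𝓡 (2 * n + 1)) G p (α.reebField p) * α.form p w -
          mvfderiv (𝓡 (2 * n + 1)) G p w :=
  haveI : FiniteDimensional ℝ (TangentSpace (𝓡 (2 * n + 1)) p) :=
    inferInstanceAs (FiniteDimensional ℝ (Model (2 * n + 1)))
  existsUnique_contactVector (α.form p).toLinearMap (α.form.extDeriv p) (α.form.extDeriv_self p)
    (α.nondegenerate p) (α.reebField p) (α.reebField_spec p).1 (α.reebField_spec p).2
    (mvfderiv (𝓡 (2 * n + 1)) G p).toLinearMap (G p)

/-- The contact vector field `X_G` generated by `G`, determined by `α(X_G) = G` and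
`dα(X_G, ·) = dG(R_α) α - dG`. -/
def contactVectorField (α : ContactForm n M) (G : M → ℝ) (p : M) :
    TangentSpace (𝓡 (2 * n + 1)) p :=
  (α.existsUnique_contactVectorField G p).choose

theorem contactVectorField_spec (α : ContactForm n M) (G : M → ℝ) (p : M) :
    α.form p (α.contactVectorField G p) = G p ∧
      ∀ w : TangentSpace (𝓡 (2 * n + 1)) p,
        α.form.extDeriv p (α.contactVectorField G p) w =
          mvfderiv (𝓡 (2 * n + 1)) G p (α.reebField p) * α.form p w -
            mvfderiv (𝓡 (2 * n + 1)) G p w :=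
  (α.existsUnique_contactVectorField G p).choose_spec.1

/-- The contact Poisson bracket `{F, G}_c = dF(X_G) - dG(R_α) F`. With the convention
`α(X_G) = G` this is the sign for which the bracket is antisymmetric
(it equals `-α([X_F, X_G])`). -/
def bracket (α : ContactForm n M) (F G : M → ℝ) (p : M) : ℝ :=
  mvfderiv (𝓡 (2 * n + 1)) F p (α.contactVectorField G p) -
    mvfderiv (𝓡 (2 * n + 1)) G p (α.reebField p) * F p

/-- The expression `dF(X_G) + dG(R_α) F`, with the other sign in front of the second term. -/
def bracketPlus (α : ContactForm n M) (F G : M → ℝ) (p : M) : ℝ :=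
  mvfderiv (𝓡 (2 * n + 1)) F p (α.contactVectorField G p) +
    mvfderiv (𝓡 (2 * n + 1)) G p (α.reebField p) * F p

/-- The submanifold that is the image of the smooth embedding `i : S → M` is contact coisotropic:
`(T_pY ∩ ξ_p)^{⊥_{dα}} ⊆ T_pY ∩ ξ_p` for all its points `p = i s`, where `T_pY` is the image of the
derivative of `i` at `s`. -/
def IsContactCoisotropic (α : ContactForm n M) (k : ℕ) {S : Type*} [TopologicalSpace S]
    [ChartedSpace (Model k) S] (i : S → M) : Prop :=
  ∀ s : S,
    let W : Submodule ℝ (TangentSpace (𝓡 (2 * n + 1)) (i s)) :=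
      LinearMap.range (mfderiv (𝓡 k) (𝓡 (2 * n + 1)) i s).toLinearMap ⊓ α.hyperplane (i s)
    α.orthogonal (i s) W ≤ W

end ContactForm

end Contact

/-! ### Function spaces -/

section Functions

variable {d : ℕ} {M : Type*} [TopologicalSpace M] [ChartedSpace (Model d) M]

/-- `C_c^∞(M)`, as a (non-unital) algebra of functions on `M`. -/
def smoothCompactlySupported (d : ℕ) (M : Type*) [TopologicalSpace M]
    [ChartedSpace (Model d) M] : NonUnitalSubalgebra ℝ (M → ℝ) where
  carrier := {F | ContMDiff (𝓡 d) 𝓘(ℝ, ℝ) ∞ F ∧ HasCompactSupport F}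
  add_mem' := fun hF hG => ⟨hF.1.add hG.1, hF.2.add hG.2⟩
  zero_mem' := ⟨contMDiff_const, HasCompactSupport.zero⟩
  mul_mem' := fun hF hG => ⟨hF.1.mul hG.1, hF.2.mul_right⟩
  smul_mem' := fun c F hF =>
    ⟨contMDiff_const.mul hF.1, hF.2.mono (Function.support_const_smul_subset c F)⟩

/-- `I_Y`: the smooth compactly supported functions on `M` that vanish on `Y`. -/
def vanishingIdeal (d : ℕ) {M : Type*} [TopologicalSpace M] [ChartedSpace (Model d) M]
    (Y : Set M) : Submodule ℝ (M → ℝ) where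
  carrier := {F | F ∈ smoothCompactlySupported d M ∧ ∀ y ∈ Y, F y = 0}
  add_mem' := fun hF hG =>
    ⟨add_mem hF.1 hG.1, fun y hy => by simp [hF.2 y hy, hG.2 y hy]⟩
  zero_mem' := ⟨zero_mem _, fun _ _ => rfl⟩
  smul_mem' := fun c _ hF =>
    ⟨(smoothCompactlySupported d M).smul_mem' c hF.1, fun y hy => by simp [hF.2 y hy]⟩

/-- `I_Y` is an ideal of `C_c^∞(M)`. -/
theorem mul_mem_vanishingIdeal {Y : Set M} {F G : M → ℝ} (hF : F ∈ smoothCompactlySupported d M)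
    (hG : G ∈ vanishingIdeal d Y) : F * G ∈ vanishingIdeal d Y :=
  ⟨mul_mem hF hG.1, fun y hy => by simp [hG.2 y hy]⟩

/-- The linear subspace `V` of functions is closed under the bilinear operation `B`, i.e. it is a
Lie subalgebra when `B` is a Lie bracket. -/
def IsSubalgebraUnder (B : (M → ℝ) → (M → ℝ) → (M → ℝ)) (V : Submodule ℝ (M → ℝ)) : Prop :=
  ∀ F ∈ V, ∀ G ∈ V, B F G ∈ V

end Functions

end ContactGeometry

end

/-! At a point of Y where F vanishes, both expressions reduce to dF(X_G), so the sign in front of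
the second term is irrelevant and one argument serves both equivalences
(`isContactCoisotropic_iff_isSubalgebraUnder`).

The covectors annihilating T_pY are exactly the differentials dF_p with F in I_Y
(`mvfderiv_mfderiv_eq_zero`, `exists_mem_vanishingIdeal_mvfderiv_eq`). Hence dF(X_G) vanishes on Y
for all F, G in I_Y if and only if X_G is tangent to Y for every G in I_Y. At p the vectors X_G with
G in I_Y are the v in ξ_p with dα(v, ·) = b(R)α - b, where b annihilates T_pY. By
`coisotropic_iff_forall_annihilator`, that T_pY contains all of them is the coisotropy condition.

It remains to see that the brackets stay in C_c^∞(M) (`bracket_mem`). In a fixed chart R and X_G are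
obtained by inverting v ↦ dα(v, ·) + α(v)α, which depends smoothly on the point. Since `extDeriv` at
q is defined through the chart at q, this needs its independence of the chart
(`extDeriv_apply_chart`). -/

noncomputable section

namespace ContactGeometry

/-! ### Linear algebra of the coisotropy condition -/

/-- The coisotropy condition on a subspace `T` says that `T` contains every vector `v ∈ ker a` with
`σ(v, ·) = b(r) a - b` for some covector `b` that annihilates `T`. -/
theorem coisotropic_iff_forall_annihilator {V : Type*} [AddCommGroup V] [Module ℝ V]
    (a : V →ₗ[ℝ] ℝ) (σ : V →ₗ[ℝ] V →ₗ[ℝ] ℝ) (r : V) (hr1 : a r = 1)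
    (hσ : ∀ v, σ v v = 0) (hr : ∀ w, σ r w = 0) (T : Submodule ℝ V) :
    (∀ v, a v = 0 → (∀ w ∈ T, a w = 0 → σ v w = 0) → v ∈ T) ↔
      ∀ b : V →ₗ[ℝ] ℝ, (∀ w ∈ T, b w = 0) → ∀ v, a v = 0 →
        (∀ w, σ v w = b r * a w - b w) → v ∈ T := by
  have hskew : ∀ v, σ v r = 0 := fun v => by
    have := hσ (v + r)
    simp [hσ, hr] at this
    exact this
  refine ⟨fun h b hb v hv hvb => h v hv fun w hw haw => by rw [hvb, haw, hb w hw]; ring,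
    fun h v hv hvT => ?_⟩
  -- On `T` the functional `σ v` vanishes wherever `a` does, so it is a multiple of `a` there.
  obtain ⟨c, hc⟩ : ∃ c : ℝ, ∀ w ∈ T, σ v w = c * a w := by
    by_cases hT : ∀ w ∈ T, a w = 0
    · exact ⟨0, fun w hw => by rw [hvT w hw (hT w hw), zero_mul]⟩
    · push Not at hT
      obtain ⟨t, ht, hat⟩ := hT
      refine ⟨σ v t / a t, fun w hw => ?_⟩
      have := hvT (a t • w - a w • t) (T.sub_mem (T.smul_mem _ hw) (T.smul_mem _ ht))
        (by simp [mul_comm])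
      simp at this
      field_simp
      linarith
  -- For this covector `b` one has `b r = c`, because `a r = 1` and `σ v r = 0`; hence `b r • a - b
  -- = σ v`.
  refine h (c • a - σ v) (fun w hw => by simp [hc w hw]) v hv fun w => ?_
  simp [hr1, hskew]

/-! ### Chart independence of the exterior derivative -/

/-- The exterior derivative of 1-forms on `ℝ^d` commutes with pullback. -/
theorem flatExtDeriv_pullback {d : ℕ} {b β : Model d → (Model d →L[ℝ] ℝ)}
    {τ : Model d → Model d} {y : Model d} (hτ : ContDiffAt ℝ 2 τ y)
    (hβ : DifferentiableAt ℝ β (τ y))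
    (hb : b =ᶠ[𝓝 y] fun z => (β (τ z)).comp (fderiv ℝ τ z)) (u v : Model d) :
    flatExtDeriv b y u v = flatExtDeriv β (τ y) (fderiv ℝ τ y u) (fderiv ℝ τ y v) := by
  have hτ1 : DifferentiableAt ℝ τ y := hτ.differentiableAt (by norm_num)
  have hτ2 : DifferentiableAt ℝ (fderiv ℝ τ) y :=
    (hτ.fderiv_right (m := 1) (by norm_num)).differentiableAt (by norm_num)
  have hder : ∀ u v, fderiv ℝ b y u v =
      fderiv ℝ β (τ y) (fderiv ℝ τ y u) (fderiv ℝ τ y v) +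
        β (τ y) (fderiv ℝ (fderiv ℝ τ) y u v) := fun u v => by
    have h1 : HasFDerivAt (fun z => β (τ z)) ((fderiv ℝ β (τ y)).comp (fderiv ℝ τ y)) y :=
      hβ.hasFDerivAt.comp y hτ1.hasFDerivAt
    have h2 := h1.clm_comp hτ2.hasFDerivAt
    rw [hb.fderiv_eq, h2.fderiv]
    simp [add_comm]
  -- The second-derivative terms are symmetric and cancel in the antisymmetrization.
  have hsymm : fderiv ℝ (fderiv ℝ τ) y u v = fderiv ℝ (fderiv ℝ τ) y v u :=
    (hτ.isSymmSndFDerivAt (by simp)).eq u v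
  change fderiv ℝ b y u v - fderiv ℝ b y v u = _ - _
  rw [hder, hder, hsymm]
  ring

section Charts

variable {d : ℕ} {M : Type*} [TopologicalSpace M] [ChartedSpace (Model d) M]

theorem OneForm.inChart_apply_extChartAt (a : OneForm d M) {p q : M}
    (hq : q ∈ (extChartAt (𝓡 d) p).source) (u : Model d) :
    a.inChart p (extChartAt (𝓡 d) p q) u = a q
      (mfderiv 𝓘(ℝ, Model d) (𝓡 d) (extChartAt (𝓡 d) p).symm (extChartAt (𝓡 d) p q) u) := by
  -- All tangent spaces unfold to `Model d`, so replacing the base point by a variable avoids a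
  -- dependent rewrite.
  have h : ∀ q', q' = q → ∀ w : Model d, a q' w = a q w := by rintro _ rfl _; rfl
  exact h _ ((extChartAt (𝓡 d) p).left_inv hq) _

variable [IsManifold (𝓡 d) ∞ M]

theorem mfderiv_extChartAt_symm_mfderiv {p q : M} (hq : q ∈ (extChartAt (𝓡 d) p).source)
    (u : TangentSpace (𝓡 d) q) :
    (mfderiv 𝓘(ℝ, Model d) (𝓡 d) (extChartAt (𝓡 d) p).symm (extChartAt (𝓡 d) p q)
      (mfderiv (𝓡 d) 𝓘(ℝ, Model d) (extChartAt (𝓡 d) p) q u) : Model d) = u := by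
  have h := mfderivWithin_extChartAt_symm_comp_mfderiv_extChartAt' (I := 𝓡 d) hq
  rw [ModelWithCorners.range_eq_univ, mfderivWithin_univ] at h
  exact DFunLike.congr_fun h u

theorem mfderiv_mfderiv_extChartAt_symm {p q : M} (hq : q ∈ (extChartAt (𝓡 d) p).source)
    (u : Model d) :
    (mfderiv (𝓡 d) 𝓘(ℝ, Model d) (extChartAt (𝓡 d) p) q
      (mfderiv 𝓘(ℝ, Model d) (𝓡 d) (extChartAt (𝓡 d) p).symm (extChartAt (𝓡 d) p q) u)
        : Model d) = u := by
  have h := mfderiv_extChartAt_comp_mfderivWithin_extChartAt_symm' (I := 𝓡 d) hq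
  rw [ModelWithCorners.range_eq_univ, mfderivWithin_univ] at h
  exact DFunLike.congr_fun h u

theorem OneForm.inChart_apply_mfderiv (a : OneForm d M) {p q : M}
    (hq : q ∈ (extChartAt (𝓡 d) p).source) (u : TangentSpace (𝓡 d) q) :
    a.inChart p (extChartAt (𝓡 d) p q)
      (mfderiv (𝓡 d) 𝓘(ℝ, Model d) (extChartAt (𝓡 d) p) q u) = a q u := by
  exact (a.inChart_apply_extChartAt hq _).trans (congrArg (a q) (mfderiv_extChartAt_symm_mfderiv hq u))

/-- A smooth 1-form has smooth expressions in charts. -/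
theorem OneForm.IsSmooth.contDiffAt_inChart {a : OneForm d M} (ha : a.IsSmooth) {p q : M}
    (hq : q ∈ (extChartAt (𝓡 d) p).source) :
    ContDiffAt ℝ ∞ (a.inChart p) (extChartAt (𝓡 d) p q) := by
  have hsm : ContMDiffAt (𝓡 d) 𝓘(ℝ, Model d →L[ℝ] ℝ) ∞
      (fun x => a.inChart p (extChartAt (𝓡 d) p x)) q := by
    let e := trivializationAt (Model d →L[ℝ] ℝ)
      (fun p : M => TangentSpace (𝓡 d) p →L[ℝ] Bundle.Trivial M ℝ p) p
    have h := (e.contMDiffAt_iff (IB := 𝓡 d) (n := ∞)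
      (f := fun p : M => (Bundle.TotalSpace.mk' (Model d →L[ℝ] ℝ) p (a p) :
      Bundle.TotalSpace (Model d →L[ℝ] ℝ)
        (fun p : M => TangentSpace (𝓡 d) p →L[ℝ] Bundle.Trivial M ℝ p))) (x₀ := q)
        (by rw [hom_trivializationAt_source]
            exact ⟨by simpa using hq, trivial⟩)).mp (ha q)
    refine h.2.congr_of_eventuallyEq ?_
    filter_upwards [(isOpen_extChartAt_source (I := 𝓡 d) p).mem_nhds hq] with x hx
    ext u
    rw [a.inChart_apply_extChartAt hx]
    have hx' : x ∈ (chartAt (Model d) p).source := by simpa using hx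
    -- The inverse of the tangent trivialization is the derivative of the inverse chart, so the
    -- bundle coordinates of `a` are its expression `inChart`.
    have h1 := TangentBundle.symmL_trivializationAt (I := 𝓡 d) hx'
    rw [ModelWithCorners.range_eq_univ, mfderivWithin_univ] at h1
    rw [← h1, hom_trivializationAt_apply]
    simp [ContinuousLinearMap.inCoordinates]
    rfl
  have h2 := hsm.comp_of_eq (contMDiffOn_extChartAt_symm (I := 𝓡 d) (n := ∞) p |>.contMDiffAt
    ((isOpen_extChartAt_target (I := 𝓡 d) p).mem_nhds ((extChartAt (𝓡 d) p).map_source hq)))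
    ((extChartAt (𝓡 d) p).left_inv hq)
  refine h2.contDiffAt.congr_of_eventuallyEq ?_
  filter_upwards [(isOpen_extChartAt_target (I := 𝓡 d) p).mem_nhds
    ((extChartAt (𝓡 d) p).map_source hq)] with y hy
  simp only [Function.comp_apply]
  rw [(extChartAt (𝓡 d) p).right_inv hy]

/-- The exterior derivative of a smooth 1-form may be computed in any chart. -/
theorem OneForm.IsSmooth.extDeriv_apply_chart {a : OneForm d M} (ha : a.IsSmooth) {p q : M}
    (hq : q ∈ (extChartAt (𝓡 d) p).source) (u v : TangentSpace (𝓡 d) q) :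
    a.extDeriv q u v = flatExtDeriv (a.inChart p) (extChartAt (𝓡 d) p q)
      (mfderiv (𝓡 d) 𝓘(ℝ, Model d) (extChartAt (𝓡 d) p) q u)
      (mfderiv (𝓡 d) 𝓘(ℝ, Model d) (extChartAt (𝓡 d) p) q v) := by
  set φ := extChartAt (𝓡 d) p with hφ
  set ψ := extChartAt (𝓡 d) q with hψ
  have hqψ : q ∈ ψ.source := mem_extChartAt_source q
  have hyψ : ψ q ∈ ψ.target := ψ.map_source hqψ
  have hU : ∀ᶠ y in 𝓝 (ψ q), y ∈ ψ.target ∧ ψ.symm y ∈ φ.source := by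
    refine Filter.Eventually.and ((isOpen_extChartAt_target q).mem_nhds hyψ) ?_
    have hc : ContinuousAt ψ.symm (ψ q) := continuousAt_extChartAt_symm q
    refine hc.eventually_mem ((isOpen_extChartAt_source p).mem_nhds ?_)
    rwa [ψ.left_inv hqψ]
  have hder : ∀ y, y ∈ ψ.target → ψ.symm y ∈ φ.source → ∀ u : Model d,
      (fderiv ℝ (φ ∘ ψ.symm) y u : Model d) =
        mfderiv (𝓡 d) 𝓘(ℝ, Model d) φ (ψ.symm y) (mfderiv 𝓘(ℝ, Model d) (𝓡 d) ψ.symm y u) := by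
    intro y hy hy' u
    have hd1 : MDifferentiableAt 𝓘(ℝ, Model d) (𝓡 d) ψ.symm y := by
      have := mdifferentiableWithinAt_extChartAt_symm (I := 𝓡 d) hy
      rwa [ModelWithCorners.range_eq_univ, mdifferentiableWithinAt_univ] at this
    have hd2 : MDifferentiableAt (𝓡 d) 𝓘(ℝ, Model d) φ (ψ.symm y) :=
      mdifferentiableAt_extChartAt (by simpa [hφ] using hy')
    rw [← mfderiv_eq_fderiv]
    exact mfderiv_comp_apply y hd2 hd1 u
  have hτ : ContDiffAt ℝ 2 (φ ∘ ψ.symm) (ψ q) := by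
    have := contDiffWithinAt_ext_coord_change (I := 𝓡 d) (n := ∞) p q (y := ψ q)
      (by
        rw [PartialEquiv.trans_source]
        exact ⟨hyψ, show ψ.symm (ψ q) ∈ φ.source by rwa [ψ.left_inv hqψ]⟩)
    rw [ModelWithCorners.range_eq_univ, contDiffWithinAt_univ] at this
    exact this.of_le (show ((2 : ℕ∞) : ℕ∞ω) ≤ ∞ from mod_cast le_top)
  -- The two chart expressions differ by pullback along the transition map.
  have hb : a.inChart q =ᶠ[𝓝 (ψ q)] fun z =>
      (a.inChart p ((φ ∘ ψ.symm) z)).comp (fderiv ℝ (φ ∘ ψ.symm) z) := by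
    filter_upwards [hU] with y hy
    ext u
    rw [ContinuousLinearMap.comp_apply, hder y hy.1 hy.2]
    exact (a.inChart_apply_mfderiv hy.2 _).symm
  have hτq : (φ ∘ ψ.symm) (ψ q) = φ q := by simp [ψ.left_inv hqψ]
  have hβ : DifferentiableAt ℝ (a.inChart p) ((φ ∘ ψ.symm) (ψ q)) := by
    rw [hτq]
    exact (ha.contDiffAt_inChart hq).differentiableAt (by simp)
  have hcomp : ∀ u : TangentSpace (𝓡 d) q, (fderiv ℝ (φ ∘ ψ.symm) (ψ q)
      (mfderiv (𝓡 d) 𝓘(ℝ, Model d) ψ q u) : Model d) =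
        mfderiv (𝓡 d) 𝓘(ℝ, Model d) φ q u := by
    intro u
    refine (hder (ψ q) hyψ (by rwa [ψ.left_inv hqψ]) _).trans ?_
    have hg : ∀ q', q' = q → ∀ w : Model d, (mfderiv (𝓡 d) 𝓘(ℝ, Model d) φ q' w : Model d) =
      mfderiv (𝓡 d) 𝓘(ℝ, Model d) φ q w := by rintro _ rfl _; rfl
    refine (hg _ (ψ.left_inv hqψ) _).trans ?_
    exact congrArg (mfderiv (𝓡 d) 𝓘(ℝ, Model d) φ q) (mfderiv_extChartAt_symm_mfderiv hqψ u)
  refine (flatExtDeriv_pullback hτ hβ hb _ _).trans ?_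
  rw [hτq]
  exact congrArg₂ (fun u v => flatExtDeriv (a.inChart p) (φ q) u v) (hcomp u) (hcomp v)

end Charts

/-! ### Differentials of functions in charts -/

section Charts

variable {d : ℕ} {M : Type*} [TopologicalSpace M] [ChartedSpace (Model d) M]
  [IsManifold (𝓡 d) ∞ M]

theorem contDiffAt_comp_extChartAt_symm {G : M → ℝ} (hG : ContMDiff (𝓡 d) 𝓘(ℝ, ℝ) ∞ G) {p q : M}
    (hq : q ∈ (extChartAt (𝓡 d) p).source) :
    ContDiffAt ℝ ∞ (G ∘ (extChartAt (𝓡 d) p).symm) (extChartAt (𝓡 d) p q) :=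
  (hG.contMDiffAt.comp _ ((contMDiffOn_extChartAt_symm (I := 𝓡 d) (n := ∞) p).contMDiffAt
    ((isOpen_extChartAt_target (I := 𝓡 d) p).mem_nhds
      ((extChartAt (𝓡 d) p).map_source hq)))).contDiffAt

theorem mvfderiv_eq_fderiv_chart {G : M → ℝ} (hG : ContMDiff (𝓡 d) 𝓘(ℝ, ℝ) ∞ G) {p q : M}
    (hq : q ∈ (extChartAt (𝓡 d) p).source) (w : TangentSpace (𝓡 d) q) :
    mvfderiv (𝓡 d) G q w = fderiv ℝ (G ∘ (extChartAt (𝓡 d) p).symm) (extChartAt (𝓡 d) p q)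
      (mfderiv (𝓡 d) 𝓘(ℝ, Model d) (extChartAt (𝓡 d) p) q w) := by
  have heq : G =ᶠ[𝓝 q] (G ∘ (extChartAt (𝓡 d) p).symm) ∘ extChartAt (𝓡 d) p := by
    filter_upwards [(isOpen_extChartAt_source (I := 𝓡 d) p).mem_nhds hq] with x hx
    exact (congrArg G ((extChartAt (𝓡 d) p).left_inv hx)).symm
  have h1 : mfderiv (𝓡 d) 𝓘(ℝ, ℝ) G q =
      mfderiv (𝓡 d) 𝓘(ℝ, ℝ) ((G ∘ (extChartAt (𝓡 d) p).symm) ∘ extChartAt (𝓡 d) p) q :=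
    heq.mfderiv_eq
  have h2 := mfderiv_comp_apply q
    ((contDiffAt_comp_extChartAt_symm hG hq).differentiableAt (by simp)).mdifferentiableAt
    (mdifferentiableAt_extChartAt (by simpa using hq)) w
  rw [mfderiv_eq_fderiv] at h2
  exact (congrArg (fun L : Model d →L[ℝ] ℝ => L w) h1).trans h2

end Charts

/-! ### Reeb and contact vector fields on ℝ^d by operator inversion -/

section Flat

variable {d : ℕ}

/-- The linear map `v ↦ dβ(v, ·) + β(v) β` of a 1-form `β` on `ℝ^d` at the point `y`. -/
def flatContactMap (β : Model d → (Model d →L[ℝ] ℝ)) (y : Model d) :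
    Model d →L[ℝ] (Model d →L[ℝ] ℝ) :=
  fderiv ℝ β y - (fderiv ℝ β y).flip + (β y).smulRight (β y)

theorem flatContactMap_apply (β : Model d → (Model d →L[ℝ] ℝ)) (y u v : Model d) :
    flatContactMap β y u v = flatExtDeriv β y u v + β y u * β y v := by
  simp [flatContactMap, flatExtDeriv]

theorem contDiff_clm_flip {E : Type*} [NormedAddCommGroup E] [NormedSpace ℝ E]
    [FiniteDimensional ℝ E] {n : ℕ∞ω} :
    ContDiff ℝ n (fun L : E →L[ℝ] E →L[ℝ] ℝ => L.flip) :=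
  contDiff_clm_apply_iff.2 fun u => contDiff_clm_apply_iff.2 fun v => by
    simp only [ContinuousLinearMap.flip_apply]
    fun_prop

theorem contDiffAt_flatContactMap {β : Model d → (Model d →L[ℝ] ℝ)} {y : Model d}
    (hβ : ContDiffAt ℝ ∞ β y) : ContDiffAt ℝ ∞ (flatContactMap β) y := by
  have h1 : ContDiffAt ℝ ∞ (fderiv ℝ β) y := hβ.fderiv_right (m := ∞) (by simp)
  have h2 : ContDiffAt ℝ ∞ (fun z => (fderiv ℝ β z).flip) y :=
    contDiff_clm_flip.contDiffAt.comp y h1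
  exact (h1.sub h2).add (hβ.smulRight hβ)

/-- The Reeb vector field of a 1-form on `ℝ^d`. -/
def flatReeb (β : Model d → (Model d →L[ℝ] ℝ)) (y : Model d) : Model d :=
  -- The Reeb equations give dβ(R, ·) + β(R)β = β. Where the map is not invertible, `inverse` is
  -- zero.
  (flatContactMap β y).inverse (β y)

/-- The contact vector field of a function on `ℝ^d`. -/
def flatContactVector (β : Model d → (Model d →L[ℝ] ℝ)) (g : Model d → ℝ) (y : Model d) :
    Model d :=
  -- The term `g y • β y` is β(X_g)β, since β(X_g) = g.
  (flatContactMap β y).inverse ((fderiv ℝ g y (flatReeb β y) + g y) • β y - fderiv ℝ g y)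

/-- Inversion is smooth near an invertible operator, so invertibility at `y` alone suffices. -/
theorem contDiffAt_flatReeb {β : Model d → (Model d →L[ℝ] ℝ)} {y : Model d}
    (hβ : ContDiffAt ℝ ∞ β y) (hy : (flatContactMap β y).IsInvertible) :
    ContDiffAt ℝ ∞ (flatReeb β) y :=
  (hy.contDiffAt_map_inverse.comp y (contDiffAt_flatContactMap hβ)).clm_apply hβ

theorem contDiffAt_flatContactVector {β : Model d → (Model d →L[ℝ] ℝ)} {g : Model d → ℝ}
    {y : Model d} (hβ : ContDiffAt ℝ ∞ β y) (hg : ContDiffAt ℝ ∞ g y)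
    (hy : (flatContactMap β y).IsInvertible) :
    ContDiffAt ℝ ∞ (flatContactVector β g) y := by
  have hg' : ContDiffAt ℝ ∞ (fderiv ℝ g) y := hg.fderiv_right (m := ∞) (by simp)
  exact (hy.contDiffAt_map_inverse.comp y (contDiffAt_flatContactMap hβ)).clm_apply
    ((((hg'.clm_apply (contDiffAt_flatReeb hβ hy)).add hg).smul hβ).sub hg')

end Flat

/-! ### Smoothness and compact support of the brackets -/

namespace ContactForm

variable {n : ℕ} {M : Type*} [TopologicalSpace M]
  [ChartedSpace (Model (2 * n + 1)) M] [IsManifold (𝓡 (2 * n + 1)) ∞ M]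

/-- The chart at `p` stays fixed while `q` varies, as smoothness arguments require; chart
independence of `extDeriv` enters here. -/
theorem flatContactMap_mfderiv (α : ContactForm n M) {p q : M}
    (hq : q ∈ (extChartAt (𝓡 (2 * n + 1)) p).source) (u v : TangentSpace (𝓡 (2 * n + 1)) q) :
    flatContactMap (α.form.inChart p) (extChartAt (𝓡 (2 * n + 1)) p q)
      (mfderiv (𝓡 (2 * n + 1)) 𝓘(ℝ, Model (2 * n + 1)) (extChartAt (𝓡 (2 * n + 1)) p) q u)
      (mfderiv (𝓡 (2 * n + 1)) 𝓘(ℝ, Model (2 * n + 1)) (extChartAt (𝓡 (2 * n + 1)) p) q v) =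
    α.form.extDeriv q u v + α.form q u * α.form q v := by
  refine (flatContactMap_apply _ _ _ _).trans ?_
  exact congrArg₂ (· + ·) (α.smooth.extDeriv_apply_chart hq u v).symm
    (congrArg₂ (· * ·) (α.form.inChart_apply_mfderiv hq u) (α.form.inChart_apply_mfderiv hq v))

theorem isInvertible_flatContactMap (α : ContactForm n M) {p q : M}
    (hq : q ∈ (extChartAt (𝓡 (2 * n + 1)) p).source) :
    (flatContactMap (α.form.inChart p) (extChartAt (𝓡 (2 * n + 1)) p q)).IsInvertible := by
  set Φ := flatContactMap (α.form.inChart p) (extChartAt (𝓡 (2 * n + 1)) p q) with hΦ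
  have : FiniteDimensional ℝ (TangentSpace (𝓡 (2 * n + 1)) q) :=
    inferInstanceAs (FiniteDimensional ℝ (Model (2 * n + 1)))
  have hinj : Function.Injective Φ := by
    rw [injective_iff_map_eq_zero]
    intro x hx
    let u : TangentSpace (𝓡 (2 * n + 1)) q := mfderiv 𝓘(ℝ, Model (2 * n + 1)) (𝓡 (2 * n + 1))
      (extChartAt (𝓡 (2 * n + 1)) p).symm (extChartAt (𝓡 (2 * n + 1)) p q) x
    have hu : mfderiv (𝓡 (2 * n + 1)) 𝓘(ℝ, Model (2 * n + 1)) (extChartAt (𝓡 (2 * n + 1)) p) q u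
      = x := mfderiv_mfderiv_extChartAt_symm hq x
    have h0 : u = 0 := by
      apply (contact_bijective (α.form q).toLinearMap (α.form.extDeriv q) (α.form.extDeriv_self q)
        (α.nondegenerate q)).1
      ext v
      have h1 := α.flatContactMap_mfderiv hq u v
      have h2 : α.form.extDeriv q u v + α.form q u * α.form q v = 0 := by
        rw [← h1, hu, ← hΦ, hx]
        rfl
      simpa using h2
    rw [← hu, h0]
    exact map_zero (mfderiv (𝓡 (2 * n + 1)) 𝓘(ℝ, Model (2 * n + 1))
      (extChartAt (𝓡 (2 * n + 1)) p) q)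
  have hrank : Module.finrank ℝ (Model (2 * n + 1)) =
      Module.finrank ℝ (Model (2 * n + 1) →L[ℝ] ℝ) := by
    have e : (Model (2 * n + 1) →ₗ[ℝ] ℝ) ≃ₗ[ℝ] (Model (2 * n + 1) →L[ℝ] ℝ) :=
      LinearMap.toContinuousLinearMap
    rw [← e.finrank_eq]
    exact (Subspace.dual_finrank_eq (K := ℝ) (V := Model (2 * n + 1))).symm
  refine ⟨(LinearEquiv.ofInjectiveOfFinrankEq Φ.toLinearMap hinj hrank).toContinuousLinearEquiv, ?_⟩
  ext x v
  rfl

/-- Identifies vectors chosen fibrewise through their defining equations with the explicit, smooth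
formulas in the chart. -/
theorem flatContactMap_inverse_eq (α : ContactForm n M) {p q : M}
    (hq : q ∈ (extChartAt (𝓡 (2 * n + 1)) p).source) (v : TangentSpace (𝓡 (2 * n + 1)) q)
    (b : Model (2 * n + 1) →L[ℝ] ℝ)
    (h : ∀ w : TangentSpace (𝓡 (2 * n + 1)) q, α.form.extDeriv q v w + α.form q v * α.form q w =
      b (mfderiv (𝓡 (2 * n + 1)) 𝓘(ℝ, Model (2 * n + 1)) (extChartAt (𝓡 (2 * n + 1)) p) q w)) :
    (flatContactMap (α.form.inChart p) (extChartAt (𝓡 (2 * n + 1)) p q)).inverse b =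
      (mfderiv (𝓡 (2 * n + 1)) 𝓘(ℝ, Model (2 * n + 1)) (extChartAt (𝓡 (2 * n + 1)) p) q v) := by
  obtain ⟨e, he⟩ := α.isInvertible_flatContactMap hq
  have hb : b = e (mfderiv (𝓡 (2 * n + 1)) 𝓘(ℝ, Model (2 * n + 1))
      (extChartAt (𝓡 (2 * n + 1)) p) q v) := by
    ext x
    let u : TangentSpace (𝓡 (2 * n + 1)) q := mfderiv 𝓘(ℝ, Model (2 * n + 1)) (𝓡 (2 * n + 1))
      (extChartAt (𝓡 (2 * n + 1)) p).symm (extChartAt (𝓡 (2 * n + 1)) p q) x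
    have hu : mfderiv (𝓡 (2 * n + 1)) 𝓘(ℝ, Model (2 * n + 1)) (extChartAt (𝓡 (2 * n + 1)) p) q u
      = x := mfderiv_mfderiv_extChartAt_symm hq x
    have h1 := (α.flatContactMap_mfderiv hq v u).trans (h u)
    rw [hu, ← he] at h1
    exact h1.symm
  rw [← he, ContinuousLinearMap.inverse_equiv, hb]
  exact e.symm_apply_apply _

theorem flatReeb_eq (α : ContactForm n M) {p q : M}
    (hq : q ∈ (extChartAt (𝓡 (2 * n + 1)) p).source) :
    flatReeb (α.form.inChart p) (extChartAt (𝓡 (2 * n + 1)) p q) =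
      mfderiv (𝓡 (2 * n + 1)) 𝓘(ℝ, Model (2 * n + 1)) (extChartAt (𝓡 (2 * n + 1)) p) q
        (α.reebField q) := by
  refine α.flatContactMap_inverse_eq hq _ _ fun w => ?_
  rw [(α.reebField_spec q).1, (α.reebField_spec q).2, zero_add, one_mul]
  exact (α.form.inChart_apply_mfderiv hq w).symm

theorem flatContactVector_eq (α : ContactForm n M) {G : M → ℝ}
    (hG : ContMDiff (𝓡 (2 * n + 1)) 𝓘(ℝ, ℝ) ∞ G) {p q : M}
    (hq : q ∈ (extChartAt (𝓡 (2 * n + 1)) p).source) :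
    flatContactVector (α.form.inChart p) (G ∘ (extChartAt (𝓡 (2 * n + 1)) p).symm)
        (extChartAt (𝓡 (2 * n + 1)) p q) =
      mfderiv (𝓡 (2 * n + 1)) 𝓘(ℝ, Model (2 * n + 1)) (extChartAt (𝓡 (2 * n + 1)) p) q
        (α.contactVectorField G q) := by
  refine α.flatContactMap_inverse_eq hq _ _ fun w => ?_
  rw [(α.contactVectorField_spec G q).1, (α.contactVectorField_spec G q).2, α.flatReeb_eq hq,
    mvfderiv_eq_fderiv_chart hG hq, mvfderiv_eq_fderiv_chart hG hq,
    ← α.form.inChart_apply_mfderiv hq w]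
  have key : ∀ (c : ℝ) (b b' : Model (2 * n + 1) →L[ℝ] ℝ) (x : Model (2 * n + 1)),
      (c • b - b') x = c * b x - b' x := by simp
  refine Eq.trans ?_ (key _ _ _ _).symm
  simp only [Function.comp_apply, (extChartAt (𝓡 (2 * n + 1)) p).left_inv hq]
  ring

theorem contMDiff_mvfderiv_reebField (α : ContactForm n M) {G : M → ℝ}
    (hG : ContMDiff (𝓡 (2 * n + 1)) 𝓘(ℝ, ℝ) ∞ G) :
    ContMDiff (𝓡 (2 * n + 1)) 𝓘(ℝ, ℝ) ∞
      fun q => mvfderiv (𝓡 (2 * n + 1)) G q (α.reebField q) := by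
  intro p
  have hp : p ∈ (extChartAt (𝓡 (2 * n + 1)) p).source := mem_extChartAt_source p
  have hβ := α.smooth.contDiffAt_inChart hp
  have hg := contDiffAt_comp_extChartAt_symm hG hp
  have hflat : ContDiffAt ℝ ∞ (fun y => fderiv ℝ (G ∘ (extChartAt (𝓡 (2 * n + 1)) p).symm) y
      (flatReeb (α.form.inChart p) y)) (extChartAt (𝓡 (2 * n + 1)) p p) :=
    (hg.fderiv_right (m := ∞) (by simp)).clm_apply
      (contDiffAt_flatReeb hβ (α.isInvertible_flatContactMap hp))
  refine (hflat.contMDiffAt.comp p contMDiffAt_extChartAt).congr_of_eventuallyEq ?_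
  filter_upwards [(isOpen_extChartAt_source (I := 𝓡 (2 * n + 1)) p).mem_nhds hp] with q hq
  rw [mvfderiv_eq_fderiv_chart hG hq]
  simp only [Function.comp_apply, α.flatReeb_eq hq]

theorem contMDiff_mvfderiv_contactVectorField (α : ContactForm n M) {F G : M → ℝ}
    (hF : ContMDiff (𝓡 (2 * n + 1)) 𝓘(ℝ, ℝ) ∞ F) (hG : ContMDiff (𝓡 (2 * n + 1)) 𝓘(ℝ, ℝ) ∞ G) :
    ContMDiff (𝓡 (2 * n + 1)) 𝓘(ℝ, ℝ) ∞
      fun q => mvfderiv (𝓡 (2 * n + 1)) F q (α.contactVectorField G q) := by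
  intro p
  have hp : p ∈ (extChartAt (𝓡 (2 * n + 1)) p).source := mem_extChartAt_source p
  have hβ := α.smooth.contDiffAt_inChart hp
  have hf := contDiffAt_comp_extChartAt_symm hF hp
  have hg := contDiffAt_comp_extChartAt_symm hG hp
  have hflat : ContDiffAt ℝ ∞ (fun y => fderiv ℝ (F ∘ (extChartAt (𝓡 (2 * n + 1)) p).symm) y
      (flatContactVector (α.form.inChart p) (G ∘ (extChartAt (𝓡 (2 * n + 1)) p).symm) y))
      (extChartAt (𝓡 (2 * n + 1)) p p) :=
    (hf.fderiv_right (m := ∞) (by simp)).clm_apply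
      (contDiffAt_flatContactVector hβ hg (α.isInvertible_flatContactMap hp))
  refine (hflat.contMDiffAt.comp p contMDiffAt_extChartAt).congr_of_eventuallyEq ?_
  filter_upwards [(isOpen_extChartAt_source (I := 𝓡 (2 * n + 1)) p).mem_nhds hp] with q hq
  rw [mvfderiv_eq_fderiv_chart hF hq]
  simp only [Function.comp_apply, α.flatContactVector_eq hG hq]

end ContactForm

theorem mvfderiv_eq_zero_of_notMem_tsupport {d : ℕ} {M : Type*} [TopologicalSpace M]
    [ChartedSpace (Model d) M] {F : M → ℝ} {q : M} (hq : q ∉ tsupport F) :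
    mvfderiv (𝓡 d) F q = 0 := by
  have h : mfderiv (𝓡 d) 𝓘(ℝ, ℝ) F q = mfderiv (𝓡 d) 𝓘(ℝ, ℝ) (fun _ => (0 : ℝ)) q :=
    (notMem_tsupport_iff_eventuallyEq.mp hq).mfderiv_eq
  rw [mfderiv_const] at h
  ext w
  exact congrArg (fun L : Model d →L[ℝ] ℝ => L w) h

theorem ContactForm.bracket_mem {n : ℕ} {M : Type*} [TopologicalSpace M]
    [ChartedSpace (Model (2 * n + 1)) M] [IsManifold (𝓡 (2 * n + 1)) ∞ M]
    (α : ContactForm n M) {F G : M → ℝ} (hF : F ∈ smoothCompactlySupported (2 * n + 1) M)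
    (hG : G ∈ smoothCompactlySupported (2 * n + 1) M) :
    α.bracket F G ∈ smoothCompactlySupported (2 * n + 1) M ∧
      α.bracketPlus F G ∈ smoothCompactlySupported (2 * n + 1) M := by
  have h1 := α.contMDiff_mvfderiv_contactVectorField hF.1 hG.1
  have h2 := (α.contMDiff_mvfderiv_reebField hG.1).mul hF.1
  -- Each term contains F or dF, so the support is controlled by F alone.
  have hsupp : ∀ q, q ∉ tsupport F →
      mvfderiv (𝓡 (2 * n + 1)) F q (α.contactVectorField G q) = 0 ∧ F q = 0 := fun q hq =>
    ⟨by rw [mvfderiv_eq_zero_of_notMem_tsupport hq]; rfl, image_eq_zero_of_notMem_tsupport hq⟩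
  refine ⟨⟨h1.sub h2, hF.2.mono' fun q hq => ?_⟩, ⟨h1.add h2, hF.2.mono' fun q hq => ?_⟩⟩ <;>
  · by_contra hn
    exact hq (by simp [bracket, bracketPlus, hsupp q hn])

/-! ### Conormal covectors as differentials of functions in I_Y -/

section Submanifold

variable {d k : ℕ} {M : Type*} [TopologicalSpace M] [ChartedSpace (Model d) M]
  {S : Type*} [TopologicalSpace S] [ChartedSpace (Model k) S] {i : S → M}

/-- The differential of a function in `I_Y` annihilates the tangent spaces of `Y`. -/
theorem mvfderiv_mfderiv_eq_zero (hi : Manifold.IsSmoothEmbedding (𝓡 k) (𝓡 d) ∞ i) {F : M → ℝ}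
    (hF : F ∈ vanishingIdeal d (Set.range i)) (s : S) (v : TangentSpace (𝓡 k) s) :
    mvfderiv (𝓡 d) F (i s) (mfderiv (𝓡 k) (𝓡 d) i s v) = 0 := by
  have h1 := mvfderiv_comp_apply s (hF.1.1.contMDiffAt.mdifferentiableAt (by simp))
    ((hi.contMDiff s).mdifferentiableAt (by simp)) v
  have h2 : F ∘ i = fun _ => 0 := funext fun t => hF.2 _ ⟨t, rfl⟩
  rw [← h1, h2, mvfderiv_const]
  rfl

theorem mdifferentiableAt_extend_symm {e : OpenPartialHomeomorph M (Model d)}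
    (he : e ∈ IsManifold.maximalAtlas (𝓡 d) ∞ M) {q : M} (hq : q ∈ e.source) :
    MDifferentiableAt 𝓘(ℝ, Model d) (𝓡 d) (e.extend (𝓡 d)).symm (e.extend (𝓡 d) q) :=
  ((contMDiffOn_extend_symm he).contMDiffAt
    (by simpa using e.open_target.mem_nhds (e.map_source hq))).mdifferentiableAt (by simp)

/-- A covector annihilating `T_pY` is the differential at `p` of a function on a neighbourhood of
`p` that vanishes on `Y`. -/
theorem exists_local_function_mvfderiv_eq
    (hi : Manifold.IsSmoothEmbedding (𝓡 k) (𝓡 d) ∞ i) (s : S)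
    (b : TangentSpace (𝓡 d) (i s) →L[ℝ] ℝ) (hb : ∀ v, b (mfderiv (𝓡 k) (𝓡 d) i s v) = 0) :
    ∃ U ∈ 𝓝 (i s), ∃ f : M → ℝ, (∀ q ∈ U, ContMDiffAt (𝓡 d) 𝓘(ℝ, ℝ) ∞ f q) ∧
      (∀ t, i t ∈ U → f (i t) = 0) ∧ mvfderiv (𝓡 d) f (i s) = b := by
  have h := hi.isImmersion.isImmersionAt s
  let φ := h.domChart.extend (𝓡 k)
  let ψ := h.codChart.extend (𝓡 d)
  let e := h.equiv
  have hsφ : s ∈ φ.source := by simpa [φ] using h.mem_domChart_source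
  -- In immersion charts `i` is the linear inclusion `x ↦ e (x, 0)`.
  have hloc : ∀ t ∈ h.domChart.source, ψ (i t) = e (φ t, 0) := fun t ht => by
    have ht' : t ∈ φ.source := by simpa [φ] using ht
    have h1 := h.writtenInCharts (φ.map_source ht')
    simp only [Function.comp_apply] at h1
    rwa [φ.left_inv ht'] at h1
  -- Since `i` is an embedding, no other part of Y enters `U'`: there Y lies in the slice.
  obtain ⟨U', hU'o, hU'⟩ := hi.isEmbedding.isInducing.isOpen_iff.mp h.domChart.open_source
  have hψs : MDifferentiableAt 𝓘(ℝ, Model d) (𝓡 d) ψ.symm (ψ (i s)) :=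
    mdifferentiableAt_extend_symm h.codChart_mem_maximalAtlas h.mem_codChart_source
  have hψ : ∀ q ∈ h.codChart.source, ContMDiffAt (𝓡 d) 𝓘(ℝ, Model d) ∞ ψ q := fun q hq =>
    h.codChart.contMDiffAt_extend h.codChart_mem_maximalAtlas hq
  have hφs : MDifferentiableAt 𝓘(ℝ, Model k) (𝓡 k) φ.symm (φ s) :=
    mdifferentiableAt_extend_symm h.domChart_mem_maximalAtlas h.mem_domChart_source
  let c : Model d →L[ℝ] ℝ := (show Model d →L[ℝ] ℝ from b).comp
    (mfderiv 𝓘(ℝ, Model d) (𝓡 d) ψ.symm (ψ (i s)))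
  -- `Q` projects onto the directions transverse to the slice. The function sought is `c ∘ Q ∘ ψ`,
  -- with `c` the covector `b` read in the chart.
  let Q : Model d →L[ℝ] Model d := (e : (Model k × h.complement) →L[ℝ] Model d).comp
    (((ContinuousLinearMap.inr ℝ (Model k) h.complement).comp
      (ContinuousLinearMap.snd ℝ (Model k) h.complement)).comp (e.symm : Model d →L[ℝ] _))
  have hQ : ∀ x, Q x = x - e ((e.symm x).1, 0) := fun x => by
    have : e (0, (e.symm x).2) + e ((e.symm x).1, 0) = x := by
      rw [← map_add]; simp
    rw [eq_sub_iff_add_eq]; exact this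
  -- The slice directions are tangent to Y: differentiate ψ⁻¹ ∘ ι = i ∘ φ⁻¹.
  have hc : ∀ x : Model k, c (e (x, 0)) = 0 := by
    intro x
    let ι : Model k →L[ℝ] Model d := (e : (Model k × h.complement) →L[ℝ] Model d).comp
      (ContinuousLinearMap.inl ℝ (Model k) h.complement)
    have hι : ι (φ s) = ψ (i s) := (hloc s h.mem_domChart_source).symm
    have hφ' : φ.symm (φ s) = s := φ.left_inv hsφ
    have heq : ψ.symm ∘ ι =ᶠ[𝓝 (φ s)] i ∘ φ.symm := by
      have hT : φ.target ∈ 𝓝 (φ s) := by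
        simpa [φ] using h.domChart.open_target.mem_nhds (h.domChart.map_source h.mem_domChart_source)
      filter_upwards [hT] with y hy
      have hy' : φ.symm y ∈ h.domChart.source := by simpa [φ] using φ.map_target hy
      have h1 := hloc _ hy'
      rw [φ.right_inv hy] at h1
      have h2 : i (φ.symm y) ∈ ψ.source := by
        simpa [ψ] using h.source_subset_preimage_source hy'
      change ψ.symm (e (y, 0)) = _
      rw [← h1, ψ.left_inv h2]
      rfl
    have hι' : MDifferentiableAt 𝓘(ℝ, Model k) 𝓘(ℝ, Model d) ι (φ s) :=
      ι.differentiableAt.mdifferentiableAt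
    have h1 := mfderiv_comp_apply_of_eq (φ s) hψs hι' hι x
    have h2 := mfderiv_comp_apply_of_eq (φ s) ((hi.contMDiff s).mdifferentiableAt (by simp))
      hφs hφ' x
    rw [mfderiv_eq_fderiv, ι.fderiv] at h1
    have h3 : mfderiv 𝓘(ℝ, Model k) (𝓡 d) (ψ.symm ∘ ι) (φ s) =
      mfderiv 𝓘(ℝ, Model k) (𝓡 d) (i ∘ φ.symm) (φ s) := heq.mfderiv_eq
    have h4 : (mfderiv 𝓘(ℝ, Model d) (𝓡 d) ψ.symm (ψ (i s)) (e (x, 0)) : Model d) =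
        mfderiv (𝓡 k) (𝓡 d) i s (mfderiv 𝓘(ℝ, Model k) (𝓡 k) φ.symm (φ s) x) :=
      (h1.symm.trans (congrArg (fun L : Model k →L[ℝ] Model d => L x) h3)).trans h2
    exact (congrArg b h4).trans (hb _)
  refine ⟨U' ∩ h.codChart.source, Filter.inter_mem
    (hU'o.mem_nhds (by rw [← Set.mem_preimage, hU']; exact h.mem_domChart_source))
    (h.codChart.open_source.mem_nhds h.mem_codChart_source), fun q => c (Q (ψ q)), ?_, ?_, ?_⟩
  · intro q hq
    exact (c.comp Q).contMDiff.contMDiffAt.comp q (hψ q hq.2)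
  · rintro t ⟨ht, -⟩
    have ht' : t ∈ h.domChart.source := by rw [← hU']; exact ht
    change c (Q (ψ (i t))) = 0
    rw [hloc t ht', hQ]
    simp
  · ext v
    have hψ' := (hψ _ h.mem_codChart_source).mdifferentiableAt (by simp)
    have h1 := mvfderiv_comp_apply (g := c.comp Q) (i s)
      (c.comp Q).differentiableAt.mdifferentiableAt hψ' v
    have h2 := mfderiv_comp_apply (i s) hψs hψ' v
    have heq : ψ.symm ∘ ψ =ᶠ[𝓝 (i s)] id := by
      filter_upwards [h.codChart.open_source.mem_nhds h.mem_codChart_source] with q hq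
      exact ψ.left_inv (by simpa [ψ] using hq)
    have h3 : mfderiv (𝓡 d) (𝓡 d) (ψ.symm ∘ ψ) (i s) = mfderiv (𝓡 d) (𝓡 d) id (i s) :=
      heq.mfderiv_eq
    rw [mfderiv_id] at h3
    have h4 : (mfderiv 𝓘(ℝ, Model d) (𝓡 d) ψ.symm (ψ (i s))
        (mfderiv (𝓡 d) 𝓘(ℝ, Model d) ψ (i s) v) : Model d) = v :=
      h2.symm.trans (congrArg (fun L : Model d →L[ℝ] Model d => L v) h3)
    -- As `c` kills the slice directions, projecting by `Q` loses nothing and the differential is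
    -- `b`.
    have h5 : ∀ x : Model d, c (Q x) = c x := fun x => by rw [hQ, map_sub, hc, sub_zero]
    have h6 : ∀ y, mvfderiv 𝓘(ℝ, Model d) (c.comp Q) y = c.comp Q := fun y => by
      ext x
      have := mfderiv_eq_fderiv (𝕜 := ℝ) (f := c.comp Q) (x := y)
      rw [(c.comp Q).fderiv] at this
      exact congrArg (fun L : Model d →L[ℝ] ℝ => L x) this
    rw [h6] at h1
    exact (h1.trans (h5 _)).trans (congrArg b h4)

variable [T2Space M] [IsManifold (𝓡 d) ∞ M]

/-- Every covector annihilating `T_pY` is the differential of a function in `I_Y`. -/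
theorem exists_mem_vanishingIdeal_mvfderiv_eq
    (hi : Manifold.IsSmoothEmbedding (𝓡 k) (𝓡 d) ∞ i) (s : S)
    (b : TangentSpace (𝓡 d) (i s) →L[ℝ] ℝ) (hb : ∀ v, b (mfderiv (𝓡 k) (𝓡 d) i s v) = 0) :
    ∃ F ∈ vanishingIdeal d (Set.range i), mvfderiv (𝓡 d) F (i s) = b := by
  obtain ⟨U, hU, f, hf, hfY, hdf⟩ := exists_local_function_mvfderiv_eq hi s b hb
  -- Only the inclusion `tsupport χ ⊆ U` matters, since `f` is controlled only on `U`.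
  obtain ⟨χ, hχ, -⟩ := (SmoothBumpFunction.nhds_basis_support (I := 𝓡 d) hU).mem_iff.mp
    Filter.univ_mem
  refine ⟨fun q => χ q * f q, ⟨⟨?_, ?_⟩, ?_⟩, ?_⟩
  · refine contMDiff_of_tsupport fun x hx => ?_
    have hxU : x ∈ U := hχ (closure_mono (Function.support_mul_subset_left _ _) hx)
    exact χ.contMDiffAt.mul (hf x hxU)
  · exact χ.hasCompactSupport.mul_right
  · rintro _ ⟨t, rfl⟩
    by_cases ht : i t ∈ U
    · simp [hfY t ht]
    · have : χ (i t) = 0 := by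
        by_contra h
        exact ht (hχ (subset_closure h))
      simp [this]
  · have heq : (fun q => χ q * f q) =ᶠ[𝓝 (i s)] f := by
      filter_upwards [χ.eventuallyEq_one] with q hq
      simp [hq]
    rw [← hdf]
    have h : mfderiv (𝓡 d) 𝓘(ℝ, ℝ) (fun q => χ q * f q) (i s) = mfderiv (𝓡 d) 𝓘(ℝ, ℝ) f (i s) :=
      heq.mfderiv_eq
    ext w
    exact congrArg (fun L : Model d →L[ℝ] ℝ => L w) h

end Submanifold

/-! ### The equivalence for both sign conventions -/

theorem ContactForm.isContactCoisotropic_iff_isSubalgebraUnder {n k : ℕ} {M : Type*}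
    [TopologicalSpace M] [T2Space M] [ChartedSpace (Model (2 * n + 1)) M]
    [IsManifold (𝓡 (2 * n + 1)) ∞ M] (α : ContactForm n M)
    {S : Type*} [TopologicalSpace S] [ChartedSpace (Model k) S] [IsManifold (𝓡 k) ∞ S]
    {i : S → M} (hi : Manifold.IsSmoothEmbedding (𝓡 k) (𝓡 (2 * n + 1)) ∞ i)
    (B : (M → ℝ) → (M → ℝ) → (M → ℝ))
    (hB : ∀ F ∈ smoothCompactlySupported (2 * n + 1) M,
      ∀ G ∈ smoothCompactlySupported (2 * n + 1) M, B F G ∈ smoothCompactlySupported (2 * n + 1) M)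
    (hB' : ∀ F G p, F p = 0 → B F G p = mvfderiv (𝓡 (2 * n + 1)) F p (α.contactVectorField G p)) :
    α.IsContactCoisotropic k i ↔
      IsSubalgebraUnder B (vanishingIdeal (2 * n + 1) (Set.range i)) := by
  have hlin : ∀ s, _ := fun s => coisotropic_iff_forall_annihilator
    (α.form (i s)).toLinearMap (α.form.extDeriv (i s)) (α.reebField (i s))
    (α.reebField_spec (i s)).1 (α.form.extDeriv_self (i s)) (α.reebField_spec (i s)).2
    (LinearMap.range (mfderiv (𝓡 k) (𝓡 (2 * n + 1)) i s).toLinearMap)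
  have hco : α.IsContactCoisotropic k i ↔ ∀ s (v : TangentSpace (𝓡 (2 * n + 1)) (i s)),
      α.form (i s) v = 0 →
      (∀ w ∈ LinearMap.range (mfderiv (𝓡 k) (𝓡 (2 * n + 1)) i s).toLinearMap,
        α.form (i s) w = 0 → α.form.extDeriv (i s) v w = 0) →
      v ∈ LinearMap.range (mfderiv (𝓡 k) (𝓡 (2 * n + 1)) i s).toLinearMap :=
    ⟨fun h s v hv hw => (h s ⟨hv, fun w hw' => hw w hw'.1 hw'.2⟩).1,
      fun h s v hv => ⟨h s v hv.1 fun w hw hw' => hv.2 w ⟨hw, hw'⟩, hv.1⟩⟩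
  rw [hco]
  constructor
  · intro h F hF G hG
    refine ⟨hB F hF.1 G hG.1, ?_⟩
    rintro _ ⟨s, rfl⟩
    rw [hB' F G _ (hF.2 _ ⟨s, rfl⟩)]
    obtain ⟨u, hu⟩ := (hlin s).mp (h s) (mvfderiv (𝓡 (2 * n + 1)) G (i s)).toLinearMap
      (by rintro _ ⟨u, rfl⟩; exact mvfderiv_mfderiv_eq_zero hi hG s u)
      (α.contactVectorField G (i s))
      ((α.contactVectorField_spec G (i s)).1.trans (hG.2 _ ⟨s, rfl⟩))
      (α.contactVectorField_spec G (i s)).2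
    rw [← hu]
    exact mvfderiv_mfderiv_eq_zero hi hF s u
  · intro h s
    have hfin : FiniteDimensional ℝ (TangentSpace (𝓡 (2 * n + 1)) (i s)) :=
      inferInstanceAs (FiniteDimensional ℝ (Model (2 * n + 1)))
    have hT2 : T2Space (TangentSpace (𝓡 (2 * n + 1)) (i s)) :=
      inferInstanceAs (T2Space (Model (2 * n + 1)))
    refine (hlin s).mpr fun b hb v hv hvb => ?_
    by_contra hvT
    -- A covector that annihilates the tangent space but not `v`; realized as dF, it gives dF(X_G) ≠
    -- 0.
    obtain ⟨a, hav, ha⟩ := Submodule.exists_le_ker_of_notMem hvT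
    obtain ⟨G, hG, hGb⟩ := exists_mem_vanishingIdeal_mvfderiv_eq hi s
      (LinearMap.toContinuousLinearMap b) (fun u => hb _ ⟨u, rfl⟩)
    obtain ⟨F, hF, hFa⟩ := exists_mem_vanishingIdeal_mvfderiv_eq hi s
      (LinearMap.toContinuousLinearMap a) (fun u => ha ⟨u, rfl⟩)
    -- Both sides solve the equations that determine X_G, because dG = b and G vanishes at the
    -- point.
    have hvG : v = α.contactVectorField G (i s) := by
      refine (α.existsUnique_contactVectorField G (i s)).unique ⟨?_, ?_⟩
        (α.contactVectorField_spec G (i s))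
      · exact hv.trans (hG.2 _ ⟨s, rfl⟩).symm
      · rw [hGb]
        exact hvb
    have h0 := (h F hF G hG).2 _ ⟨s, rfl⟩
    rw [hB' F G _ (hF.2 _ ⟨s, rfl⟩), ← hvG, hFa] at h0
    exact hav h0

end ContactGeometry

end

theorem mainTheorem5 (n k : ℕ) {M : Type*} [TopologicalSpace M] [T2Space M]
    [ChartedSpace (ContactGeometry.Model (2 * n + 1)) M] [IsManifold (𝓡 (2 * n + 1)) ∞ M]
    (α : ContactGeometry.ContactForm n M)
    {S : Type*} [TopologicalSpace S] [ChartedSpace (ContactGeometry.Model k) S]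
    [IsManifold (𝓡 k) ∞ S]
    (i : S → M) (hi : Manifold.IsSmoothEmbedding (𝓡 k) (𝓡 (2 * n + 1)) ∞ i) :
    (α.IsContactCoisotropic k i ↔
      ContactGeometry.IsSubalgebraUnder α.bracket
        (ContactGeometry.vanishingIdeal (2 * n + 1) (Set.range i))) ∧
    (α.IsContactCoisotropic k i ↔
      ContactGeometry.IsSubalgebraUnder α.bracketPlus
        (ContactGeometry.vanishingIdeal (2 * n + 1) (Set.range i))) :=
  ⟨α.isContactCoisotropic_iff_isSubalgebraUnder hi α.bracket
      (fun _ hF _ hG => (α.bracket_mem hF hG).1)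
      fun _ _ _ h => by simp [ContactGeometry.ContactForm.bracket, h],
    α.isContactCoisotropic_iff_isSubalgebraUnder hi α.bracketPlus
      (fun _ hF _ hG => (α.bracket_mem hF hG).2)
      fun _ _ _ h => by simp [ContactGeometry.ContactForm.bracketPlus, h]⟩
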